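/- Let $\mathbb{C}\langle \mathbf{x}\rangle=\mathbb{C}\langle x_1,\dots,x_d\rangle$ be the $*$-algebra of polynomials in $d$ non-commuting self-adjoint variables. A functional is a unital linear map $\mathbb{C}\langle\mathbf{x}\rangle\to\mathbb{C}$; a state is a functional $\phi$ with $\phi[P^*]=\overline{\phi[P]}$ and $\phi[P^*P]\ge 0$ for all $P$. For $\mathbf{a}\in\mathbb{R}^d$, $\delta_{\mathbf{a}}[P]=P(a_1,\dots,a_d)$. In non-commuting indeterminates, let $M^\phi(\mathbf{w})=\sum_{|\vec u|\ge 1}\phi[x_{\vec u}]w_{\vec u}$ and $(1+M)\mathbf{w}=((1+M)w_1,\dots,(1+M)w_d)$, and define the Boolean, free and conditionally free cumulant generating functions by $$\eta^\phi=1-(1+M^\phi)^{-1},\qquad M^\psi(\mathbf{w})=R^\psi\bigl((1+M^\psi(\mathbf{w}))\mathbf{w}\bigr),\qquad \eta^\phi(\mathbf{w})=(1+M^\psi(\mathbf{w}))^{-1}R^{\phi,\psi}\bigl((1+M^\psi(\mathbf{w}))\mathbf{w}\bigr).$$ The functionals $\phi\boxplus\psi$, $\phi^{\boxplus t}$, $\phi\uplus\psi$,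 $\phi^{\uplus t}$ ($t\in\mathbb{R}$) are determined by $R^{\phi\boxplus\psi}=R^\phi+R^\psi$, $R^{\phi^{\boxplus t}}=tR^\phi$, $\eta^{\phi\uplus\psi}=\eta^\phi+\eta^\psi$, $\eta^{\phi^{\uplus t}}=t\eta^\phi$. A functional $\rho$ is a freely infinitely divisible state if $\rho_t:=\rho^{\boxplus t}$ is a state for every $t\ge 0$. The functional $\Phi[\rho,\psi]$ is determined by $$\eta^{\Phi[\rho,\psi]}(\mathbf{w})=(1+M^\psi(\mathbf{w}))^{-1}R^\rho\bigl((1+M^\psi(\mathbf{w}))\mathbf{w}\bigr).$$ For $t\ne-1$ let $\mathfrak{B}_{\mathbf{a},t}[\phi]=\bigl((\phi^{\boxplus(1+t)}\boxplus\delta_{\mathbf{a}})\uplus\delta_{-\mathbf{a}}\bigr)^{\uplus 1/(1+t)}$ and $\mathfrak{B}_t[\phi]=(\phi^{\boxplus(1+t)})^{\uplus 1/(1+t)}$. **Theorem.** Let $\rho$ be a freely infinitely divisible state with free convolution semigroup $\{\rho_t\}$, let $\psi$ be a state, $\mathbf{a}\in\mathbb{R}^d$ and $t\ge 0$. (a)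 $\Phi[\rho^{\boxplus t}\boxplus\delta_{\mathbf{a}},\psi]=\Phi[\rho,\psi]^{\uplus t}\uplus\delta_{\mathbf{a}}$. (b) $\Phi[\rho,\psi\boxplus\rho_t]=\mathfrak{B}_t[\Phi[\rho,\psi]]$. Equivalently, if $R^{\phi,\psi}=R^\rho$, then $R^{\mathfrak{B}_t[\phi],\,\psi\boxplus\rho_t}=R^{\phi,\psi}=R^\rho$. More generally, $$\Phi[\rho,\psi\boxplus\rho^{\boxplus t}\boxplus\delta_{\mathbf{a}}]=\mathfrak{B}_{\mathbf{a},t}[\Phi[\rho,\psi]]=\mathfrak{B}_t[\Phi[\rho,\psi\boxplus\delta_{\mathbf{a}}]]=\mathfrak{B}_{\mathbf{a},0}[\Phi[\rho,\psi\boxplus\rho_t]].$$ Moreover, with $\rho_t$ replaced by $\rho^{\boxplus t}$, the same identities hold for arbitrary functionals $\rho,\psi$: (a) for all $t\in\mathbb{R}$, and (b) for all real $t\ne-1$. -/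

import Mathlib

open scoped ComplexOrder

noncomputable section

/-! ### Formal power series in non-commuting variables -/

/-- Formal power series over `ℂ` in the non-commuting variables `z_1, …, z_d`: a series assigns to
each word `u` in the letters `Fin d` the coefficient of `z_u`. -/
@[ext] structure NCSeries (d : ℕ) : Type where
  coeff : List (Fin d) → ℂ

namespace NCSeries

variable {d : ℕ}

instance : CoeFun (NCSeries d) fun _ => List (Fin d) → ℂ := ⟨coeff⟩

instance : Zero (NCSeries d) := ⟨⟨fun _ => 0⟩⟩

instance : Add (NCSeries d) := ⟨fun F G => ⟨fun w => F w + G w⟩⟩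

instance : Neg (NCSeries d) := ⟨fun F => ⟨fun w => -F w⟩⟩

instance : Sub (NCSeries d) := ⟨fun F G => ⟨fun w => F w - G w⟩⟩

instance {S : Type*} [SMul S ℂ] : SMul S (NCSeries d) := ⟨fun c F => ⟨fun w => c • F w⟩⟩

theorem coeff_injective : Function.Injective (coeff : NCSeries d → List (Fin d) → ℂ) :=
  fun _ _ h => NCSeries.ext h

instance : AddCommGroup (NCSeries d) :=
  coeff_injective.addCommGroup coeff rfl (fun _ _ => rfl) (fun _ => rfl) (fun _ _ => rfl)
    (fun _ _ => rfl) (fun _ _ => rfl)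

instance : Module ℂ (NCSeries d) :=
  coeff_injective.module ℂ ⟨⟨coeff, rfl⟩, fun _ _ => rfl⟩ (fun _ _ => rfl)

theorem ext' {F G : NCSeries d} (h : ∀ w, F w = G w) : F = G := NCSeries.ext (funext h)

theorem add_apply (F G : NCSeries d) (w : List (Fin d)) : (F + G) w = F w + G w := rfl

theorem sub_apply (F G : NCSeries d) (w : List (Fin d)) : (F - G) w = F w - G w := rfl

theorem zero_apply (w : List (Fin d)) : (0 : NCSeries d) w = 0 := rfl

theorem smul_apply (c : ℂ) (F : NCSeries d) (w : List (Fin d)) : (c • F) w = c * F w := rfl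

instance : One (NCSeries d) := ⟨⟨fun w => if w = [] then 1 else 0⟩⟩

/-- The product of series: words are multiplied by concatenation. -/
instance : Mul (NCSeries d) :=
  ⟨fun F G => ⟨fun w => ∑ k ∈ Finset.range (w.length + 1), F (w.take k) * G (w.drop k)⟩⟩

/-- The variable `z_i`. -/
def X (i : Fin d) : NCSeries d := ⟨fun w => if w = [i] then 1 else 0⟩

theorem one_apply (w : List (Fin d)) : (1 : NCSeries d) w = if w = [] then 1 else 0 := rfl

theorem mul_apply (F G : NCSeries d) (w : List (Fin d)) :
    (F * G) w = ∑ k ∈ Finset.range (w.length + 1), F (w.take k) * G (w.drop k) := rfl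

theorem mul_nil (F G : NCSeries d) : (F * G) [] = F [] * G [] := by
  simp [mul_apply]

/-- The left derivative `D_i`, which removes an initial letter `i`. -/
def leftD (i : Fin d) (F : NCSeries d) : NCSeries d := ⟨fun w => F (i :: w)⟩

theorem mul_cons (F G : NCSeries d) (i : Fin d) (w : List (Fin d)) :
    (F * G) (i :: w) = F [] * G (i :: w) + (leftD i F * G) w := by
  rw [mul_apply, mul_apply, List.length_cons, Finset.sum_range_succ']
  simp [leftD, add_comm]

protected theorem add_mul' (F G H : NCSeries d) : (F + G) * H = F * H + G * H := by
  refine ext' fun w => ?_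
  simp only [mul_apply, add_apply, add_mul, Finset.sum_add_distrib]

protected theorem mul_add' (F G H : NCSeries d) : F * (G + H) = F * G + F * H := by
  refine ext' fun w => ?_
  simp only [mul_apply, add_apply, mul_add, Finset.sum_add_distrib]

protected theorem smul_mul' (c : ℂ) (F G : NCSeries d) : (c • F) * G = c • (F * G) := by
  refine ext' fun w => ?_
  simp only [mul_apply, smul_apply, Finset.mul_sum, mul_assoc]

theorem leftD_mul (i : Fin d) (F G : NCSeries d) :
    leftD i (F * G) = F [] • leftD i G + leftD i F * G := by
  refine ext' fun w => ?_
  exact mul_cons F G i w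

protected theorem mul_assoc' (F G H : NCSeries d) : F * G * H = F * (G * H) := by
  refine ext' fun w => ?_
  induction w generalizing F G H with
  | nil => simp only [mul_nil, mul_assoc]
  | cons i w ih =>
    rw [mul_cons, mul_cons, mul_cons, mul_nil, leftD_mul, NCSeries.add_mul', add_apply,
      NCSeries.smul_mul', smul_apply, ih]
    ring

protected theorem one_mul' (F : NCSeries d) : 1 * F = F := by
  refine ext' fun w => ?_
  rw [mul_apply, Finset.sum_range_succ', Finset.sum_eq_zero]
  · simp [one_apply]
  · intro k hk
    rw [Finset.mem_range] at hk
    have : w ≠ [] := by rintro rfl; simp at hk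
    simp [one_apply, this]

protected theorem mul_one' (F : NCSeries d) : F * 1 = F := by
  refine ext' fun w => ?_
  rw [mul_apply, Finset.sum_range_succ, Finset.sum_eq_zero]
  · simp [one_apply]
  · intro k hk
    rw [Finset.mem_range] at hk
    simp [one_apply, hk]

instance : Ring (NCSeries d) :=
  { (inferInstance : AddCommGroup (NCSeries d)) with
    mul := (· * ·)
    one := 1
    left_distrib := NCSeries.mul_add'
    right_distrib := NCSeries.add_mul'
    zero_mul := fun F => by refine ext' fun w => ?_; simp [mul_apply, zero_apply]
    mul_zero := fun F => by refine ext' fun w => ?_; simp [mul_apply, zero_apply]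
    mul_assoc := NCSeries.mul_assoc'
    one_mul := NCSeries.one_mul'
    mul_one := NCSeries.mul_one' }

/-- The product `(G z_{u(1)}) (G z_{u(2)}) ⋯ (G z_{u(n)})`. -/
def wordProd (G : NCSeries d) (u : List (Fin d)) : NCSeries d := (u.map fun i => G * X i).prod

/-- The substitution `F(G z_1, …, G z_d) = ∑_u F_u (G z_{u(1)}) ⋯ (G z_{u(n)})`. Words `u` longer
than `w` do not contribute to the coefficient of `z_w`, so that the sum is finite. -/
def substMul (F G : NCSeries d) : NCSeries d :=
  ⟨fun w => ∑ k ∈ Finset.range (w.length + 1), ∑ u : Fin k → Fin d,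
    F (List.ofFn u) * wordProd G (List.ofFn u) w⟩

/-! Existence and uniqueness of the series that are defined implicitly below. -/

/-- A map for which the coefficients of degree `n` of the image depend only on the coefficients of
degree less than `n` has a unique fixed point. -/
theorem existsUnique_fixedPoint (T : NCSeries d → NCSeries d)
    (hT : ∀ (n : ℕ) (F G : NCSeries d), (∀ w, w.length < n → F w = G w) →
      ∀ w, w.length = n → T F w = T G w) :
    ∃! F, T F = F := by
  have key : ∀ (n m k : ℕ) (F G : NCSeries d), n ≤ m → n ≤ k →
      ∀ w, w.length < n → (T^[m] F) w = (T^[k] G) w := by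
    intro n
    induction n with
    | zero => intro m k F G _ _ w hw; omega
    | succ n ih =>
      intro m k F G hm hk w hw
      obtain ⟨m, rfl⟩ : ∃ m', m = m' + 1 := ⟨m - 1, by omega⟩
      obtain ⟨k, rfl⟩ : ∃ k', k = k' + 1 := ⟨k - 1, by omega⟩
      rw [Function.iterate_succ_apply', Function.iterate_succ_apply']
      exact hT w.length _ _
        (fun v hv => ih m k F G (by omega) (by omega) v (by omega)) w rfl
  refine ⟨⟨fun w => (T^[w.length + 1] 0) w⟩, ?_, ?_⟩
  · refine ext' fun w => ?_
    change _ = (T^[w.length + 1] 0) w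
    rw [Function.iterate_succ_apply']
    exact hT w.length _ _
      (fun v hv => key (v.length + 1) _ _ 0 0 le_rfl (by omega) v (by omega)) w rfl
  · intro F hF
    refine ext' fun w => ?_
    have h : T^[w.length + 1] F = F := Function.iterate_fixed hF _
    rw [← h]
    exact key (w.length + 1) _ _ F 0 le_rfl le_rfl w (by omega)

theorem isUnit_of_nil_eq_one {F : NCSeries d} (hF : F [] = 1) : IsUnit F := by
  have hN : (1 - F) [] = 0 := by rw [sub_apply, hF]; simp [one_apply]
  obtain ⟨L, hL, -⟩ := existsUnique_fixedPoint (fun G => 1 + G * (1 - F)) (by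
    intro n G H h w hw
    simp only [add_apply, mul_apply]
    congr 1
    refine Finset.sum_congr rfl fun k hk => ?_
    rw [Finset.mem_range] at hk
    by_cases hk' : k = w.length
    · simp [hk', hN]
    · rw [h (w.take k) (by rw [List.length_take]; omega)])
  obtain ⟨R, hR, -⟩ := existsUnique_fixedPoint (fun G => 1 + (1 - F) * G) (by
    intro n G H h w hw
    simp only [add_apply, mul_apply]
    congr 1
    refine Finset.sum_congr rfl fun k hk => ?_
    rw [Finset.mem_range] at hk
    by_cases hk' : k = 0
    · simp [hk', hN]
    · rw [h (w.drop k) (by rw [List.length_drop]; omega)])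
  have hL' : L * F = 1 := by
    have h : 1 + L * (1 - F) = L := hL
    rw [mul_sub, mul_one, ← add_sub_assoc, sub_eq_iff_eq_add, add_comm] at h
    exact (add_left_cancel h).symm
  have hR' : F * R = 1 := by
    have h : 1 + (1 - F) * R = R := hR
    rw [sub_mul, one_mul, ← add_sub_assoc, sub_eq_iff_eq_add, add_comm] at h
    exact (add_left_cancel h).symm
  exact ⟨⟨F, R, hR', by rw [← left_inv_eq_right_inv hL' hR', hL']⟩, rfl⟩

theorem mul_X_nil (G : NCSeries d) (i : Fin d) : (G * X i) [] = 0 := by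
  simp [mul_nil, X]

theorem mul_X_congr {n : ℕ} {G H : NCSeries d} (h : ∀ w, w.length < n → G w = H w) (i : Fin d)
    (w : List (Fin d)) (hw : w.length ≤ n) : (G * X i) w = (H * X i) w := by
  rw [mul_apply, mul_apply]
  refine Finset.sum_congr rfl fun k hk => ?_
  rw [Finset.mem_range] at hk
  by_cases hk' : k = w.length
  · simp [hk', X]
  · rw [h (w.take k) (by rw [List.length_take]; omega)]

theorem wordProd_cons (G : NCSeries d) (i : Fin d) (u : List (Fin d)) :
    wordProd G (i :: u) = G * X i * wordProd G u := by
  simp [wordProd]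

theorem wordProd_congr {n : ℕ} {G H : NCSeries d} (h : ∀ w, w.length < n → G w = H w)
    (u w : List (Fin d)) (hw : w.length ≤ n) : wordProd G u w = wordProd H u w := by
  induction u generalizing w with
  | nil => simp [wordProd]
  | cons i u ih =>
    rw [wordProd_cons, wordProd_cons, mul_apply, mul_apply]
    refine Finset.sum_congr rfl fun k hk => ?_
    rw [mul_X_congr h i _ (by rw [List.length_take]; omega),
      ih _ (by rw [List.length_drop]; omega)]

theorem wordProd_of_length_le {G : NCSeries d} (hG : G [] = 1) (u w : List (Fin d))
    (hw : w.length ≤ u.length) : wordProd G u w = if u = w then 1 else 0 := by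
  induction u generalizing w with
  | nil =>
    obtain rfl : w = [] := List.length_eq_zero_iff.1 (by simpa using hw)
    simp [wordProd, one_apply]
  | cons i u ih =>
    rw [wordProd_cons]
    cases w with
    | nil => simp [mul_nil, X]
    | cons j w =>
      rw [List.length_cons, List.length_cons] at hw
      rw [mul_cons, mul_X_nil, zero_mul, zero_add, mul_apply, Finset.sum_range_succ',
        Finset.sum_eq_zero]
      · have hj : leftD j (G * X i) [] = if i = j then 1 else 0 := by
          simp [leftD, mul_cons, mul_nil, X, hG, eq_comm]
        simp only [List.take_zero, List.drop_zero, hj, ih w (by omega), List.cons.injEq, zero_add]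
        by_cases h1 : i = j <;> by_cases h2 : u = w <;> simp [h1, h2]
      · intro k hk
        rw [Finset.mem_range] at hk
        rw [ih _ (by rw [List.length_drop]; omega), if_neg, mul_zero]
        rintro rfl
        rw [List.length_drop] at hw
        omega

theorem substMul_apply (F G : NCSeries d) (w : List (Fin d)) :
    substMul F G w = ∑ k ∈ Finset.range (w.length + 1), ∑ u : Fin k → Fin d,
      F (List.ofFn u) * wordProd G (List.ofFn u) w := rfl

theorem substMul_nil (F G : NCSeries d) : substMul F G [] = F [] := by
  simp [substMul, wordProd, one_apply]

theorem substMul_eq {G : NCSeries d} (hG : G [] = 1) (F : NCSeries d) (w : List (Fin d)) :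
    substMul F G w = (∑ k ∈ Finset.range w.length, ∑ u : Fin k → Fin d,
      F (List.ofFn u) * wordProd G (List.ofFn u) w) + F w := by
  rw [substMul_apply, Finset.sum_range_succ]
  congr 1
  rw [Finset.sum_eq_single (fun i => w.get i)]
  · rw [wordProd_of_length_le hG _ _ (by simp)]
    simp
  · intro u _ hu
    rw [wordProd_of_length_le hG _ _ (by simp), if_neg, mul_zero]
    intro h
    apply hu
    apply List.ofFn_injective
    rw [h]
    simp
  · simp

theorem existsUnique_substMul_eq {G : NCSeries d} (hG : G [] = 1) (S : NCSeries d) :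
    ∃! R, substMul R G = S := by
  have h := existsUnique_fixedPoint (fun R => S - (substMul R G - R)) (by
    intro n F H h w hw
    simp only [sub_apply, substMul_eq hG, add_sub_cancel_right]
    congr 1
    refine Finset.sum_congr rfl fun k hk => Finset.sum_congr rfl fun u _ => ?_
    rw [Finset.mem_range] at hk
    rw [h _ (by rw [List.length_ofFn]; omega)])
  refine (existsUnique_congr fun R => ?_).1 h
  constructor
  · intro h
    have h' : S - (substMul R G - R) = R := h
    rw [sub_eq_iff_eq_add, add_sub_cancel] at h'
    exact h'.symm
  · rintro rfl
    simp

theorem existsUnique_eq_substMul (R : NCSeries d) (hR : R [] = 0) :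
    ∃! M : NCSeries d, M [] = 0 ∧ M = substMul R (1 + M) := by
  have h := existsUnique_fixedPoint (fun M => substMul R (1 + M)) (by
    intro n F H h w hw
    rw [substMul_apply, substMul_apply]
    refine Finset.sum_congr rfl fun k hk => Finset.sum_congr rfl fun u _ => ?_
    rw [wordProd_congr (n := n) (fun v hv => ?_) _ _ hw.le]
    rw [add_apply, add_apply, h v hv])
  refine (existsUnique_congr fun M => ?_).1 h
  constructor
  · intro h
    have h' : substMul R (1 + M) = M := h
    exact ⟨by rw [← h', substMul_nil, hR], h'.symm⟩
  · exact fun h => h.2.symm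

end NCSeries

/-! ### Functionals on non-commutative polynomials -/

/-- The monomial `x_u = x_{u(1)} ⋯ x_{u(n)}` in `ℂ⟨x_1, …, x_d⟩`. -/
def ncMonomial {d : ℕ} (u : List (Fin d)) : FreeAlgebra ℂ (Fin d) :=
  (u.map (FreeAlgebra.ι ℂ)).prod

/-- The involution of the `*`-algebra `ℂ⟨x_1, …, x_d⟩`: it is conjugate linear, reverses products
and fixes the variables. (The instance `star` of `FreeAlgebra` is linear instead.) -/
def ncAdjoint {d : ℕ} (P : FreeAlgebra ℂ (Fin d)) : FreeAlgebra ℂ (Fin d) :=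
  ((FreeAlgebra.basisFreeMonoid ℂ (Fin d)).repr P).sum fun u c =>
    starRingEnd ℂ c • ncMonomial u.toList.reverse

/-- Unital linear functionals on `ℂ⟨x_1, …, x_d⟩`. -/
structure NCFunctional (d : ℕ) where
  toLin : FreeAlgebra ℂ (Fin d) →ₗ[ℂ] ℂ
  map_one : toLin 1 = 1

namespace NCFunctional

open NCSeries

variable {d : ℕ}

/-- States: `*`-compatible, positive definite functionals. -/
def IsState (φ : NCFunctional d) : Prop :=
  (∀ P, φ.toLin (ncAdjoint P) = starRingEnd ℂ (φ.toLin P)) ∧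
    ∀ P, 0 ≤ φ.toLin (ncAdjoint P * P)

/-- The functional `δ_a`, evaluation at the point `a`. -/
def delta (a : Fin d → ℝ) : NCFunctional d where
  toLin := (FreeAlgebra.lift ℂ fun i => (a i : ℂ)).toLinearMap
  map_one := by simp

/-- The moment generating function `M^φ`, without constant term. -/
def momentSeries (φ : NCFunctional d) : NCSeries d :=
  ⟨fun u => if u = [] then 0 else φ.toLin (ncMonomial u)⟩

theorem momentSeries_nil (φ : NCFunctional d) : φ.momentSeries [] = 0 := by
  simp [momentSeries]

theorem one_add_momentSeries_nil (φ : NCFunctional d) : (1 + φ.momentSeries) [] = 1 := by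
  simp [add_apply, one_apply, momentSeries_nil]

theorem basisFreeMonoid_apply (u : List (Fin d)) :
    FreeAlgebra.basisFreeMonoid ℂ (Fin d) (FreeMonoid.ofList u) = ncMonomial u := by
  have h : (FreeMonoid.lift (FreeAlgebra.ι ℂ (X := Fin d))) (FreeMonoid.ofList u) =
      ncMonomial u := by
    simp [FreeMonoid.lift_apply, ncMonomial]
  simp [FreeAlgebra.basisFreeMonoid, FreeAlgebra.equivMonoidAlgebraFreeMonoid, h]

theorem existsUnique_momentSeries_eq (M : NCSeries d) (hM : M [] = 0) :
    ∃! φ : NCFunctional d, φ.momentSeries = M := by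
  let b := FreeAlgebra.basisFreeMonoid ℂ (Fin d)
  refine ⟨⟨b.constr ℂ fun u => (1 + M) u.toList, ?_⟩, ?_, ?_⟩
  · have h : (1 : FreeAlgebra ℂ (Fin d)) = b (FreeMonoid.ofList []) := by
      rw [basisFreeMonoid_apply]; simp [ncMonomial]
    rw [h, Module.Basis.constr_basis]
    simp [add_apply, one_apply, hM]
  · refine ext' fun w => ?_
    by_cases hw : w = []
    · simp [momentSeries, hw, hM]
    · have h : ncMonomial w = b (FreeMonoid.ofList w) := (basisFreeMonoid_apply w).symm
      simp only [momentSeries, hw, if_false, h, Module.Basis.constr_basis]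
      simp [add_apply, one_apply, hw]
  · intro φ hφ
    have h : φ.toLin = b.constr ℂ fun u => (1 + M) u.toList := by
      refine b.ext fun u => ?_
      rw [Module.Basis.constr_basis]
      have hu : b u = ncMonomial u.toList := basisFreeMonoid_apply u.toList
      rw [hu, ← hφ]
      by_cases hw : u.toList = []
      · rw [hw]; simp [add_apply, one_apply, momentSeries, ncMonomial, φ.map_one]
      · simp [add_apply, one_apply, momentSeries, hw]
    cases φ
    simp only at h
    subst h
    rfl

/-- The Boolean cumulant generating function `η^φ = 1 - (1 + M^φ)⁻¹`. -/
def boolCumulant (φ : NCFunctional d) : NCSeries d := 1 - Ring.inverse (1 + φ.momentSeries)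

theorem boolCumulant_nil (φ : NCFunctional d) : φ.boolCumulant [] = 0 := by
  have h := congrArg (fun F : NCSeries d => F []) (Ring.mul_inverse_cancel _
    (isUnit_of_nil_eq_one φ.one_add_momentSeries_nil))
  simp only [mul_nil, one_add_momentSeries_nil, one_mul] at h
  rw [boolCumulant, sub_apply, h, sub_self]

theorem existsUnique_boolCumulant_eq (E : NCSeries d) (hE : E [] = 0) :
    ∃! φ : NCFunctional d, φ.boolCumulant = E := by
  have hE' : (1 - E) [] = 1 := by simp [sub_apply, one_apply, hE]
  have hu := isUnit_of_nil_eq_one hE'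
  have key : ∀ φ : NCFunctional d,
      φ.momentSeries = Ring.inverse (1 - E) - 1 ↔ φ.boolCumulant = E := by
    intro φ
    have hv := isUnit_of_nil_eq_one φ.one_add_momentSeries_nil
    rw [boolCumulant, eq_sub_iff_add_eq', sub_eq_iff_eq_add, ← sub_eq_iff_eq_add']
    constructor
    · intro h
      rw [h, Ring.inverse_inverse hu]
    · intro h
      rw [h, Ring.inverse_inverse hv]
  refine (existsUnique_congr key).1 (existsUnique_momentSeries_eq _ ?_)
  have h := congrArg (fun F : NCSeries d => F []) (Ring.mul_inverse_cancel _ hu)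
  simp only [mul_nil, hE', one_mul] at h
  rw [NCSeries.sub_apply, h, sub_self]

/-- The free cumulant generating function `R^ψ`, the unique series with
`M^ψ(w) = R^ψ((1 + M^ψ(w)) w)`. -/
def freeCumulant (ψ : NCFunctional d) : NCSeries d :=
  (existsUnique_substMul_eq ψ.one_add_momentSeries_nil ψ.momentSeries).choose

theorem substMul_freeCumulant (ψ : NCFunctional d) :
    substMul ψ.freeCumulant (1 + ψ.momentSeries) = ψ.momentSeries :=
  (existsUnique_substMul_eq ψ.one_add_momentSeries_nil ψ.momentSeries).choose_spec.1

theorem freeCumulant_nil (ψ : NCFunctional d) : ψ.freeCumulant [] = 0 := by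
  rw [← substMul_nil ψ.freeCumulant (1 + ψ.momentSeries), substMul_freeCumulant, momentSeries_nil]

theorem existsUnique_freeCumulant_eq (R : NCSeries d) (hR : R [] = 0) :
    ∃! ψ : NCFunctional d, ψ.freeCumulant = R := by
  have key : ∀ ψ : NCFunctional d,
      ψ.freeCumulant = R ↔ ψ.momentSeries = substMul R (1 + ψ.momentSeries) := by
    intro ψ
    constructor
    · rintro rfl
      exact ψ.substMul_freeCumulant.symm
    · intro h
      exact (existsUnique_substMul_eq ψ.one_add_momentSeries_nil ψ.momentSeries).unique
        ψ.substMul_freeCumulant h.symm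
  obtain ⟨M, ⟨hM0, hM⟩, hM'⟩ := existsUnique_eq_substMul R hR
  refine (existsUnique_congr fun ψ => ?_).1 (existsUnique_momentSeries_eq M hM0)
  rw [key]
  constructor
  · rintro rfl
    exact hM
  · intro h
    exact hM' _ ⟨ψ.momentSeries_nil, h⟩

theorem existsUnique_condFreeCumulant (φ ψ : NCFunctional d) :
    ∃! R : NCSeries d, φ.boolCumulant =
      Ring.inverse (1 + ψ.momentSeries) * substMul R (1 + ψ.momentSeries) := by
  have hu := isUnit_of_nil_eq_one ψ.one_add_momentSeries_nil
  refine (existsUnique_congr fun R => ?_).1 (existsUnique_substMul_eq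
    ψ.one_add_momentSeries_nil ((1 + ψ.momentSeries) * φ.boolCumulant))
  constructor
  · intro h
    rw [h, ← mul_assoc, Ring.inverse_mul_cancel _ hu, one_mul]
  · intro h
    rw [h, ← mul_assoc, Ring.mul_inverse_cancel _ hu, one_mul]

/-- The conditionally free cumulant generating function `R^{φ,ψ}`, the unique series with
`η^φ(w) = (1 + M^ψ(w))⁻¹ R^{φ,ψ}((1 + M^ψ(w)) w)`. -/
def condFreeCumulant (φ ψ : NCFunctional d) : NCSeries d :=
  (existsUnique_condFreeCumulant φ ψ).choose

/-! ### Convolutions and the transformations -/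

/-- The free convolution `φ ⊞ ψ`, the functional with `R^{φ ⊞ ψ} = R^φ + R^ψ`. -/
def freeConv (φ ψ : NCFunctional d) : NCFunctional d :=
  (existsUnique_freeCumulant_eq (φ.freeCumulant + ψ.freeCumulant)
    (by rw [add_apply, freeCumulant_nil, freeCumulant_nil, add_zero])).choose

/-- The free convolution power `φ^{⊞ t}`, the functional with free cumulants `t R^φ`. -/
def freePow (φ : NCFunctional d) (t : ℝ) : NCFunctional d :=
  (existsUnique_freeCumulant_eq ((t : ℂ) • φ.freeCumulant)
    (by rw [smul_apply, freeCumulant_nil, mul_zero])).choose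

/-- The Boolean convolution `φ ⊎ ψ`, the functional with `η^{φ ⊎ ψ} = η^φ + η^ψ`. -/
def boolConv (φ ψ : NCFunctional d) : NCFunctional d :=
  (existsUnique_boolCumulant_eq (φ.boolCumulant + ψ.boolCumulant)
    (by rw [add_apply, boolCumulant_nil, boolCumulant_nil, add_zero])).choose

/-- The Boolean convolution power `φ^{⊎ t}`, the functional with Boolean cumulants `t η^φ`. -/
def boolPow (φ : NCFunctional d) (t : ℝ) : NCFunctional d :=
  (existsUnique_boolCumulant_eq ((t : ℂ) • φ.boolCumulant)
    (by rw [smul_apply, boolCumulant_nil, mul_zero])).choose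

/-- `ρ` is a freely infinitely divisible state: `ρ^{⊞ t}` is a state for all `t ≥ 0`. -/
def IsFreelyInfinitelyDivisible (ρ : NCFunctional d) : Prop :=
  ∀ t : ℝ, 0 ≤ t → (ρ.freePow t).IsState

/-- The functional `Φ[ρ, ψ]`, whose Boolean cumulant generating function is
`(1 + M^ψ(w))⁻¹ R^ρ((1 + M^ψ(w)) w)`. -/
def Phi (ρ ψ : NCFunctional d) : NCFunctional d :=
  (existsUnique_boolCumulant_eq
    (Ring.inverse (1 + ψ.momentSeries) * substMul ρ.freeCumulant (1 + ψ.momentSeries))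
    (by rw [mul_nil, substMul_nil, freeCumulant_nil, mul_zero])).choose

/-- The transformation
`𝔹_{a,t}[φ] = ((φ^{⊞ (1+t)} ⊞ δ_a) ⊎ δ_{-a})^{⊎ 1/(1+t)}`, for `t ≠ -1`. -/
def BTwo (a : Fin d → ℝ) (t : ℝ) (φ : NCFunctional d) : NCFunctional d :=
  (((φ.freePow (1 + t)).freeConv (delta a)).boolConv (delta (-a))).boolPow (1 / (1 + t))

/-- The Belinschi-Nica transformation `𝔹_t[φ] = (φ^{⊞ (1+t)})^{⊎ 1/(1+t)}`, for `t ≠ -1`. -/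
def BOne (t : ℝ) (φ : NCFunctional d) : NCFunctional d :=
  (φ.freePow (1 + t)).boolPow (1 / (1 + t))

end NCFunctional

end

/-!
Write `G = 1 + M^ψ` and `G ∘ H = G(H w) H`, so that `F(G w)` at `H w` is `F((G ∘ H) w)`. Every `G'`
can be written `G ∘ H`; for `G' = 1 + M^{ψ'}` with `ψ' = ψ ⊞ ρ^{⊞ t} ⊞ δ_a`, the series `H` is the
subordination function of `ψ'` with respect to `ψ`. Let `φ = Φ[ρ, ψ]` and `e = η^φ(H w)`.
Substituting `H w` in `G η^φ = R^ρ(G w)` gives `G(H w) e = R^ρ(G' w)`, and then the cumulant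
equation of `ψ'`, divided by `G(H w)`, becomes `H = 1 + t e + H η^{δ_a}`. Neither `ρ` nor `ψ` occurs
in this equation except through `φ`, and it says that `H` is also the subordination function of
`φ^{⊞ (1 + t)} ⊞ δ_a` with respect to `φ`; it follows that `H η^{𝔹_{a,t}[φ]} = e`. Multiplying by
`G(H w)` gives `G' η^{𝔹_{a,t}[φ]} = R^ρ(G' w)`, the defining equation of `Φ[ρ, ψ']`.
-/

namespace NCSeries

variable {d : ℕ}

instance : Algebra ℂ (NCSeries d) :=
  Algebra.ofModule NCSeries.smul_mul' fun c F G => by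
    refine ext' fun w => ?_
    simp only [mul_apply, smul_apply, Finset.mul_sum, mul_left_comm]

theorem sum_apply {ι : Type*} (s : Finset ι) (F : ι → NCSeries d) (w : List (Fin d)) :
    (∑ i ∈ s, F i) w = ∑ i ∈ s, F i w :=
  map_sum (⟨⟨fun F => F w, rfl⟩, fun _ _ => rfl⟩ : NCSeries d →+ ℂ) F s

theorem mul_apply_congr_of_nil_eq_zero {P F G : NCSeries d} (hP : P [] = 0) (w : List (Fin d))
    (h : ∀ v : List (Fin d), v.length < w.length → F v = G v) : (P * F) w = (P * G) w := by
  rw [mul_apply, mul_apply]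
  refine Finset.sum_congr rfl fun k hk => ?_
  rw [Finset.mem_range] at hk
  rcases eq_or_ne k 0 with rfl | hk0
  · simp [hP]
  · rw [h _ (by rw [List.length_drop]; omega)]

theorem X_nil (i : Fin d) : (X i) [] = 0 := by
  simp [X]

theorem wordProd_apply_of_length_lt (G : NCSeries d) (u w : List (Fin d))
    (h : w.length < u.length) : wordProd G u w = 0 := by
  induction u generalizing w with
  | nil => simp at h
  | cons i u ih =>
    rw [List.length_cons] at h
    rw [wordProd_cons, mul_apply_congr_of_nil_eq_zero (G := 0) (mul_X_nil G i) w
      fun v hv => ih v (by omega), mul_zero, zero_apply]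

theorem substMul_apply_of_length_lt (F G : NCSeries d) (w : List (Fin d)) {n : ℕ}
    (hn : w.length < n) :
    substMul F G w = ∑ k ∈ Finset.range n, ∑ u : Fin k → Fin d,
      F (List.ofFn u) * wordProd G (List.ofFn u) w := by
  rw [substMul_apply]
  refine Finset.sum_subset (Finset.range_mono hn) fun k _ hk => Finset.sum_eq_zero fun u _ => ?_
  rw [Finset.mem_range] at hk
  rw [wordProd_apply_of_length_lt _ _ _ (by rw [List.length_ofFn]; omega), mul_zero]

theorem mul_X_mul_substMul_leftD_apply (F G : NCSeries d) (i : Fin d) (w : List (Fin d)) :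
    (G * X i * substMul (leftD i F) G) w = ∑ k ∈ Finset.range w.length, ∑ u : Fin k → Fin d,
      F (i :: List.ofFn u) * wordProd G (i :: List.ofFn u) w := by
  have truncate : (G * X i * substMul (leftD i F) G) w =
      (G * X i * ∑ k ∈ Finset.range w.length, ∑ u : Fin k → Fin d,
        F (i :: List.ofFn u) • wordProd G (List.ofFn u)) w := by
    refine mul_apply_congr_of_nil_eq_zero (mul_X_nil G i) w fun v hv => ?_
    simp only [substMul_apply_of_length_lt _ _ _ hv, sum_apply, smul_apply, leftD]
  simp only [truncate, Finset.mul_sum, sum_apply, mul_smul_comm, smul_apply, wordProd_cons]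

theorem substMul_eq_sum_leftD (F G : NCSeries d) :
    substMul F G = F [] • 1 + ∑ i, G * X i * substMul (leftD i F) G := by
  refine ext' fun w => ?_
  simp only [add_apply, sum_apply, mul_X_mul_substMul_leftD_apply]
  rw [substMul_apply, Finset.sum_range_succ', add_comm, Finset.sum_comm]
  congr 1
  · simp [wordProd, smul_apply]
  · refine Finset.sum_congr rfl fun k _ => ?_
    rw [← (Fin.consEquiv fun _ : Fin (k + 1) => Fin d).sum_comp, Fintype.sum_prod_type]
    simp [Fin.consEquiv, List.ofFn_succ]

theorem eq_substMul_mul_of_leftD {T : NCSeries d → NCSeries d} {G C : NCSeries d}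
    (hT : ∀ F, T F = F [] • C + ∑ i, G * X i * T (leftD i F)) (F : NCSeries d) :
    T F = substMul F G * C := by
  refine ext' fun w => ?_
  induction hw : w.length using Nat.strong_induction_on generalizing w F with
  | _ n ih =>
    rw [hT, substMul_eq_sum_leftD, add_mul, smul_mul_assoc, one_mul, Finset.sum_mul]
    simp only [add_apply, sum_apply, mul_assoc (G * X _)]
    congr 1
    exact Finset.sum_congr rfl fun i _ =>
      mul_apply_congr_of_nil_eq_zero (mul_X_nil G i) w fun v hv => ih _ (hw ▸ hv) _ v rfl

theorem substMul_add (F F' G : NCSeries d) :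
    substMul (F + F') G = substMul F G + substMul F' G := by
  refine ext' fun w => ?_
  simp only [substMul_apply, add_apply, add_mul, Finset.sum_add_distrib]

theorem substMul_smul (c : ℂ) (F G : NCSeries d) : substMul (c • F) G = c • substMul F G := by
  refine ext' fun w => ?_
  simp only [substMul_apply, smul_apply, Finset.mul_sum, mul_assoc]

theorem substMul_mul (F F' G : NCSeries d) :
    substMul (F * F') G = substMul F G * substMul F' G := by
  refine eq_substMul_mul_of_leftD (T := fun F => substMul (F * F') G) (fun F => ?_) F
  rw [substMul_eq_sum_leftD (F * F'), substMul_eq_sum_leftD F', mul_nil, smul_add, smul_smul,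
    Finset.smul_sum, add_assoc, ← Finset.sum_add_distrib]
  simp only [leftD_mul, substMul_add, substMul_smul, mul_add, mul_smul_comm]

theorem leftD_one (i : Fin d) : leftD i (1 : NCSeries d) = 0 := by
  refine ext' fun w => ?_
  simp [leftD, one_apply, zero_apply]

theorem leftD_X (i j : Fin d) : leftD i (X j) = if i = j then 1 else 0 := by
  refine ext' fun w => ?_
  split_ifs with h <;> simp [leftD, X, one_apply, zero_apply, h]

theorem sum_smul_X_nil (c : Fin d → ℂ) : (∑ i, c i • X i : NCSeries d) [] = 0 := by
  simp [sum_apply, smul_apply, X_nil]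

theorem leftD_sum_smul_X (c : Fin d → ℂ) (i : Fin d) : leftD i (∑ j, c j • X j) = c i • 1 := by
  refine ext' fun w => ?_
  simp [leftD, sum_apply, smul_apply, X, one_apply, ite_and]

theorem zero_substMul (G : NCSeries d) : substMul 0 G = 0 := by
  simpa only [zero_smul] using substMul_smul 0 0 G

theorem one_substMul (G : NCSeries d) : substMul 1 G = 1 := by
  rw [substMul_eq_sum_leftD]
  simp [leftD_one, zero_substMul, one_apply]

/-- The substitution `F ↦ F(G z_1, …, G z_d)` as an endomorphism of the algebra of series. -/
def substAlgHom (G : NCSeries d) : NCSeries d →ₐ[ℂ] NCSeries d :=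
  AlgHom.ofLinearMap ⟨⟨(substMul · G), (substMul_add · · G)⟩, (substMul_smul · · G)⟩
    (one_substMul G) (substMul_mul · · G)

theorem substAlgHom_apply (F G : NCSeries d) : substAlgHom G F = substMul F G := rfl

theorem substAlgHom_X (G : NCSeries d) (j : Fin d) : substAlgHom G (X j) = G * X j := by
  rw [substAlgHom_apply, substMul_eq_sum_leftD, Finset.sum_eq_single j]
  · simp [leftD_X, one_substMul, X_nil]
  · intro i _ hij
    simp [leftD_X, hij, zero_substMul]
  · simp

theorem substAlgHom_substAlgHom (F G H : NCSeries d) :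
    substAlgHom H (substAlgHom G F) = substAlgHom (substAlgHom H G * H) F := by
  refine (eq_substMul_mul_of_leftD (T := fun F => substAlgHom H (substAlgHom G F)) (C := 1)
    (fun F => ?_) F).trans (mul_one _)
  conv_lhs => rw [substAlgHom_apply F G, substMul_eq_sum_leftD F G]
  simp only [← substAlgHom_apply, map_add, map_smul, map_one, map_sum, map_mul, substAlgHom_X,
    mul_assoc]

theorem existsUnique_substAlgHom_mul_eq {G : NCSeries d} (hG : G [] = 1) (G' : NCSeries d) :
    ∃! H, substAlgHom H G * H = G' := by
  have fixedPoint := existsUnique_fixedPoint (fun H => G' - (substAlgHom H G - 1) * H) (by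
    intro n H K hHK w hw
    have subst_congr : ∀ v : List (Fin d), v.length ≤ n → substMul G H v = substMul G K v := by
      intro v hv
      simp only [substMul_apply, wordProd_congr hHK _ v hv]
    have nil_eq_zero : (substMul G K - 1) [] = 0 := by
      simp [sub_apply, substMul_nil, hG, one_apply]
    rw [sub_apply, sub_apply, substAlgHom_apply, substAlgHom_apply,
      ← mul_apply_congr_of_nil_eq_zero nil_eq_zero w fun v hv => hHK v (hw ▸ hv),
      mul_apply, mul_apply]
    congr 1
    refine Finset.sum_congr rfl fun k _ => ?_
    rw [sub_apply, sub_apply, subst_congr _ (by rw [List.length_take]; omega)])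
  refine (existsUnique_congr fun H => ?_).1 fixedPoint
  rw [sub_mul, one_mul, sub_eq_iff_eq_add', sub_add_cancel, eq_comm]

end NCSeries

namespace NCFunctional

open NCSeries

variable {d : ℕ}

/-! ### Cumulants and convolutions -/

theorem isUnit_one_add_momentSeries (φ : NCFunctional d) : IsUnit (1 + φ.momentSeries) :=
  isUnit_of_nil_eq_one φ.one_add_momentSeries_nil

theorem ext_boolCumulant {φ ψ : NCFunctional d} (h : φ.boolCumulant = ψ.boolCumulant) : φ = ψ :=
  (existsUnique_boolCumulant_eq ψ.boolCumulant ψ.boolCumulant_nil).unique h rfl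

theorem ext_freeCumulant {φ ψ : NCFunctional d} (h : φ.freeCumulant = ψ.freeCumulant) : φ = ψ :=
  (existsUnique_freeCumulant_eq ψ.freeCumulant ψ.freeCumulant_nil).unique h rfl

theorem one_add_momentSeries_mul_one_sub_boolCumulant (φ : NCFunctional d) :
    (1 + φ.momentSeries) * (1 - φ.boolCumulant) = 1 := by
  rw [boolCumulant, sub_sub_cancel, Ring.mul_inverse_cancel _ φ.isUnit_one_add_momentSeries]

theorem one_add_momentSeries_mul_boolCumulant (φ : NCFunctional d) :
    (1 + φ.momentSeries) * φ.boolCumulant = φ.momentSeries := by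
  have h := φ.one_add_momentSeries_mul_one_sub_boolCumulant
  rwa [mul_sub, mul_one, sub_eq_iff_eq_add, add_right_inj, eq_comm] at h

theorem freeCumulant_eq_of_substAlgHom {ψ : NCFunctional d} {R : NCSeries d}
    (h : substAlgHom (1 + ψ.momentSeries) R = ψ.momentSeries) : ψ.freeCumulant = R :=
  (existsUnique_substMul_eq ψ.one_add_momentSeries_nil ψ.momentSeries).unique
    ψ.substMul_freeCumulant h

theorem one_add_momentSeries_eq_one_add_freeCumulant (ψ : NCFunctional d) :
    1 + ψ.momentSeries = 1 + substAlgHom (1 + ψ.momentSeries) ψ.freeCumulant := by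
  rw [substAlgHom_apply, substMul_freeCumulant]

theorem one_add_momentSeries_unique {ψ : NCFunctional d} {K : NCSeries d}
    (hK : K = 1 + substAlgHom K ψ.freeCumulant) : 1 + ψ.momentSeries = K := by
  rw [← sub_eq_iff_eq_add', substAlgHom_apply] at hK
  rw [← sub_add_cancel K 1, add_comm (K - 1), add_right_inj]
  refine (existsUnique_eq_substMul ψ.freeCumulant ψ.freeCumulant_nil).unique
    ⟨ψ.momentSeries_nil, ψ.substMul_freeCumulant.symm⟩ ⟨?_, ?_⟩
  · rw [hK, substMul_nil, freeCumulant_nil]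
  · rwa [add_sub_cancel]

theorem freeCumulant_freeConv (φ ψ : NCFunctional d) :
    (φ.freeConv ψ).freeCumulant = φ.freeCumulant + ψ.freeCumulant := by
  unfold freeConv
  generalize_proofs h
  exact h.choose_spec.1

theorem freeCumulant_freePow (φ : NCFunctional d) (t : ℝ) :
    (φ.freePow t).freeCumulant = (t : ℂ) • φ.freeCumulant := by
  unfold freePow
  generalize_proofs h
  exact h.choose_spec.1

theorem boolCumulant_boolConv (φ ψ : NCFunctional d) :
    (φ.boolConv ψ).boolCumulant = φ.boolCumulant + ψ.boolCumulant := by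
  unfold boolConv
  generalize_proofs h
  exact h.choose_spec.1

theorem boolCumulant_boolPow (φ : NCFunctional d) (t : ℝ) :
    (φ.boolPow t).boolCumulant = (t : ℂ) • φ.boolCumulant := by
  unfold boolPow
  generalize_proofs h
  exact h.choose_spec.1

theorem boolCumulant_Phi (ρ ψ : NCFunctional d) :
    (ρ.Phi ψ).boolCumulant =
      Ring.inverse (1 + ψ.momentSeries) * substAlgHom (1 + ψ.momentSeries) ρ.freeCumulant := by
  unfold Phi
  generalize_proofs h
  exact h.choose_spec.1

theorem eq_Phi_iff {φ ρ ψ : NCFunctional d} :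
    φ = ρ.Phi ψ ↔ (1 + ψ.momentSeries) * φ.boolCumulant =
      substAlgHom (1 + ψ.momentSeries) ρ.freeCumulant := by
  have hu := ψ.isUnit_one_add_momentSeries
  constructor
  · rintro rfl
    rw [boolCumulant_Phi, Ring.mul_inverse_cancel_left _ _ hu]
  · intro h
    apply ext_boolCumulant
    rw [boolCumulant_Phi, ← h, Ring.inverse_mul_cancel_left _ _ hu]

theorem condFreeCumulant_eq_iff {φ ρ ψ : NCFunctional d} :
    φ.condFreeCumulant ψ = ρ.freeCumulant ↔ φ = ρ.Phi ψ := by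
  have defining_eq := (existsUnique_condFreeCumulant φ ψ).choose_spec.1
  constructor
  · intro h
    rw [← condFreeCumulant, h] at defining_eq
    exact ext_boolCumulant (defining_eq.trans (boolCumulant_Phi ρ ψ).symm)
  · rintro rfl
    exact (existsUnique_condFreeCumulant _ ψ).unique defining_eq (boolCumulant_Phi ρ ψ)

theorem freeConv_right_comm (φ ψ χ : NCFunctional d) :
    (φ.freeConv ψ).freeConv χ = (φ.freeConv χ).freeConv ψ := by
  apply ext_freeCumulant
  simp only [freeCumulant_freeConv, add_right_comm]

theorem freeConv_freePow_zero (φ ρ : NCFunctional d) : φ.freeConv (ρ.freePow 0) = φ := by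
  apply ext_freeCumulant
  rw [freeCumulant_freeConv, freeCumulant_freePow, Complex.ofReal_zero, zero_smul, add_zero]

/-! ### Point masses -/

theorem one_add_momentSeries_delta_apply (a : Fin d → ℝ) (u : List (Fin d)) :
    (1 + (delta a).momentSeries) u = (u.map fun i => (a i : ℂ)).prod := by
  cases u with
  | nil => simp [one_add_momentSeries_nil]
  | cons i u =>
    simp [add_apply, one_apply, momentSeries, delta, ncMonomial, map_list_prod, Function.comp_def]

theorem momentSeries_delta (a : Fin d → ℝ) :
    (delta a).momentSeries = (∑ i, (a i : ℂ) • X i) * (1 + (delta a).momentSeries) := by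
  refine ext' fun u => ?_
  cases u with
  | nil => rw [mul_nil, sum_smul_X_nil, zero_mul, momentSeries_nil]
  | cons i u =>
    have drop_one : (delta a).momentSeries (i :: u) = (1 + (delta a).momentSeries) (i :: u) := by
      simp [NCSeries.add_apply, one_apply]
    simp only [mul_cons, sum_smul_X_nil, zero_mul, zero_add, leftD_sum_smul_X, smul_mul_assoc,
      one_mul, NCSeries.smul_apply, drop_one, one_add_momentSeries_delta_apply, List.map_cons,
      List.prod_cons]

theorem boolCumulant_delta (a : Fin d → ℝ) : (delta a).boolCumulant = ∑ i, (a i : ℂ) • X i := by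
  have left_inv : (1 - ∑ i, (a i : ℂ) • X i) * (1 + (delta a).momentSeries) = 1 := by
    rw [sub_mul, one_mul, ← momentSeries_delta, add_sub_cancel_right]
  exact (sub_right_injective (left_inv_eq_right_inv left_inv
    (one_add_momentSeries_mul_one_sub_boolCumulant _))).symm

theorem boolCumulant_delta_neg (a : Fin d → ℝ) :
    (delta (-a)).boolCumulant = -(delta a).boolCumulant := by
  simp [boolCumulant_delta]

theorem boolCumulant_delta_zero : (delta (0 : Fin d → ℝ)).boolCumulant = 0 := by
  simp [boolCumulant_delta]

theorem substAlgHom_boolCumulant_delta (a : Fin d → ℝ) (G : NCSeries d) :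
    substAlgHom G (delta a).boolCumulant = G * (delta a).boolCumulant := by
  simp only [boolCumulant_delta, map_sum, map_smul, substAlgHom_X, Finset.mul_sum, mul_smul_comm]

theorem freeCumulant_delta (a : Fin d → ℝ) : (delta a).freeCumulant = (delta a).boolCumulant :=
  freeCumulant_eq_of_substAlgHom <| by
    rw [substAlgHom_boolCumulant_delta, one_add_momentSeries_mul_boolCumulant]

theorem freeConv_delta_zero (φ : NCFunctional d) : φ.freeConv (delta 0) = φ := by
  apply ext_freeCumulant
  rw [freeCumulant_freeConv, freeCumulant_delta, boolCumulant_delta_zero, add_zero]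

theorem boolConv_delta_zero (φ : NCFunctional d) : φ.boolConv (delta 0) = φ := by
  apply ext_boolCumulant
  rw [boolCumulant_boolConv, boolCumulant_delta_zero, add_zero]

theorem BTwo_zero_left (t : ℝ) (φ : NCFunctional d) : φ.BTwo 0 t = φ.BOne t := by
  rw [BTwo, BOne, freeConv_delta_zero, neg_zero, boolConv_delta_zero]

/-! ### Subordination -/

theorem substAlgHom_mul_freeCumulant (ψ : NCFunctional d) (H : NCSeries d) :
    substAlgHom (substAlgHom H (1 + ψ.momentSeries) * H) ψ.freeCumulant =
      substAlgHom H (1 + ψ.momentSeries) - 1 := by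
  rw [← substAlgHom_substAlgHom, substAlgHom_apply ψ.freeCumulant, substMul_freeCumulant, map_add,
    _root_.map_one, add_sub_cancel_left]

theorem substAlgHom_mul_boolCumulant (φ : NCFunctional d) (H : NCSeries d) :
    substAlgHom H (1 + φ.momentSeries) * substAlgHom H φ.boolCumulant =
      substAlgHom H (1 + φ.momentSeries) - 1 := by
  rw [← map_mul, one_add_momentSeries_mul_boolCumulant, map_add, _root_.map_one,
    add_sub_cancel_left]

theorem substAlgHom_mul_boolCumulant_Phi (ρ ψ : NCFunctional d) (H : NCSeries d) :
    substAlgHom H (1 + ψ.momentSeries) * substAlgHom H (ρ.Phi ψ).boolCumulant =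
      substAlgHom (substAlgHom H (1 + ψ.momentSeries) * H) ρ.freeCumulant := by
  rw [← map_mul, eq_Phi_iff.1 rfl, substAlgHom_substAlgHom]

theorem isUnit_substAlgHom_one_add_momentSeries (φ : NCFunctional d) (H : NCSeries d) :
    IsUnit (substAlgHom H (1 + φ.momentSeries)) :=
  φ.isUnit_one_add_momentSeries.map _

theorem one_add_momentSeries_freePow_freeConv_delta (φ : NCFunctional d) (a : Fin d → ℝ) (t : ℝ)
    {H : NCSeries d}
    (hH : H = 1 + (t : ℂ) • substAlgHom H φ.boolCumulant + H * (delta a).boolCumulant) :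
    1 + ((φ.freePow (1 + t)).freeConv (delta a)).momentSeries =
      substAlgHom H (1 + φ.momentSeries) * H := by
  apply one_add_momentSeries_unique
  rw [freeCumulant_freeConv, freeCumulant_freePow, freeCumulant_delta,
    map_add _ (_ • _), map_smul, substAlgHom_mul_freeCumulant, substAlgHom_boolCumulant_delta]
  have expanded : substAlgHom H (1 + φ.momentSeries) * H = substAlgHom H (1 + φ.momentSeries) +
      (t : ℂ) • (substAlgHom H (1 + φ.momentSeries) - 1) +
        substAlgHom H (1 + φ.momentSeries) * H * (delta a).boolCumulant := by
    rw [← substAlgHom_mul_boolCumulant, mul_assoc, ← mul_smul_comm, ← mul_one_add, ← mul_add, ← hH]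
  conv_lhs => rw [expanded]
  push_cast
  module

theorem mul_boolCumulant_freePow_freeConv_delta (φ : NCFunctional d) (a : Fin d → ℝ) (t : ℝ)
    {H : NCSeries d}
    (hH : H = 1 + (t : ℂ) • substAlgHom H φ.boolCumulant + H * (delta a).boolCumulant) :
    H * ((φ.freePow (1 + t)).freeConv (delta a)).boolCumulant =
      H - 1 + substAlgHom H φ.boolCumulant := by
  apply (φ.isUnit_substAlgHom_one_add_momentSeries H).mul_left_cancel
  have moments := φ.one_add_momentSeries_freePow_freeConv_delta a t hH
  rw [← mul_assoc, ← moments, one_add_momentSeries_mul_boolCumulant,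
    eq_sub_of_add_eq' moments, mul_add, mul_sub, mul_one, substAlgHom_mul_boolCumulant]
  abel

theorem mul_boolCumulant_BTwo (φ : NCFunctional d) (a : Fin d → ℝ) {t : ℝ} (ht : t ≠ -1)
    {H : NCSeries d}
    (hH : H = 1 + (t : ℂ) • substAlgHom H φ.boolCumulant + H * (delta a).boolCumulant) :
    H * (φ.BTwo a t).boolCumulant = substAlgHom H φ.boolCumulant := by
  have ht' : (1 + t : ℂ) ≠ 0 := by
    exact_mod_cast fun h : 1 + t = 0 => ht (by linarith)
  have sub_one : H - 1 = (t : ℂ) • substAlgHom H φ.boolCumulant + H * (delta a).boolCumulant := by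
    rw [sub_eq_iff_eq_add', ← add_assoc, ← hH]
  rw [BTwo, boolCumulant_boolPow, boolCumulant_boolConv, boolCumulant_delta_neg, mul_smul_comm,
    mul_add, mul_boolCumulant_freePow_freeConv_delta φ a t hH, sub_one, mul_neg]
  push_cast
  rw [one_div, inv_smul_eq_iff₀ ht']
  module

theorem subordination_eq {ρ ψ : NCFunctional d} {a : Fin d → ℝ} {t : ℝ} {H : NCSeries d}
    (hH : substAlgHom H (1 + ψ.momentSeries) * H =
      1 + ((ψ.freeConv (ρ.freePow t)).freeConv (delta a)).momentSeries) :
    H = 1 + (t : ℂ) • substAlgHom H (ρ.Phi ψ).boolCumulant + H * (delta a).boolCumulant := by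
  apply (ψ.isUnit_substAlgHom_one_add_momentSeries H).mul_left_cancel
  rw [mul_add, mul_add, mul_one, mul_smul_comm, substAlgHom_mul_boolCumulant_Phi, ← mul_assoc]
  conv_lhs => rw [hH, one_add_momentSeries_eq_one_add_freeCumulant, ← hH, freeCumulant_freeConv,
    freeCumulant_freeConv, freeCumulant_freePow, freeCumulant_delta, map_add, map_add, map_smul,
    substAlgHom_mul_freeCumulant, substAlgHom_boolCumulant_delta]
  abel

theorem Phi_freePow_freeConv_delta (ρ ψ : NCFunctional d) (a : Fin d → ℝ) (t : ℝ) :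
    ((ρ.freePow t).freeConv (delta a)).Phi ψ = ((ρ.Phi ψ).boolPow t).boolConv (delta a) := by
  rw [eq_comm, eq_Phi_iff, boolCumulant_boolConv, boolCumulant_boolPow, freeCumulant_freeConv,
    freeCumulant_freePow, freeCumulant_delta, map_add, map_smul, substAlgHom_boolCumulant_delta,
    mul_add, mul_smul_comm, eq_Phi_iff.1 rfl]

theorem Phi_freeConv_freePow_freeConv_delta (ρ ψ : NCFunctional d) (a : Fin d → ℝ) {t : ℝ}
    (ht : t ≠ -1) :
    ρ.Phi ((ψ.freeConv (ρ.freePow t)).freeConv (delta a)) = (ρ.Phi ψ).BTwo a t := by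
  obtain ⟨H, hH, -⟩ := existsUnique_substAlgHom_mul_eq ψ.one_add_momentSeries_nil
    (1 + ((ψ.freeConv (ρ.freePow t)).freeConv (delta a)).momentSeries)
  rw [eq_comm, eq_Phi_iff, ← hH, mul_assoc, mul_boolCumulant_BTwo _ a ht (subordination_eq hH),
    substAlgHom_mul_boolCumulant_Phi]

theorem Phi_freeConv_freePow (ρ ψ : NCFunctional d) {t : ℝ} (ht : t ≠ -1) :
    ρ.Phi (ψ.freeConv (ρ.freePow t)) = (ρ.Phi ψ).BOne t := by
  rw [← BTwo_zero_left, ← Phi_freeConv_freePow_freeConv_delta ρ ψ 0 ht, freeConv_delta_zero]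

theorem condFreeCumulant_BOne {φ ψ ρ : NCFunctional d} {t : ℝ} (ht : t ≠ -1)
    (h : φ.condFreeCumulant ψ = ρ.freeCumulant) :
    (φ.BOne t).condFreeCumulant (ψ.freeConv (ρ.freePow t)) = ρ.freeCumulant := by
  rw [condFreeCumulant_eq_iff] at h ⊢
  rw [h, Phi_freeConv_freePow ρ ψ ht]

theorem BTwo_Phi_eq_BOne (ρ ψ : NCFunctional d) (a : Fin d → ℝ) {t : ℝ} (ht : t ≠ -1) :
    (ρ.Phi ψ).BTwo a t = (ρ.Phi (ψ.freeConv (delta a))).BOne t := by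
  rw [← Phi_freeConv_freePow_freeConv_delta ρ ψ a ht, ← Phi_freeConv_freePow ρ _ ht,
    freeConv_right_comm]

theorem BTwo_Phi_eq_BTwo_zero (ρ ψ : NCFunctional d) (a : Fin d → ℝ) {t : ℝ} (ht : t ≠ -1) :
    (ρ.Phi ψ).BTwo a t = (ρ.Phi (ψ.freeConv (ρ.freePow t))).BTwo a 0 := by
  rw [← Phi_freeConv_freePow_freeConv_delta ρ ψ a ht,
    ← Phi_freeConv_freePow_freeConv_delta ρ _ a (by norm_num), freeConv_freePow_zero]

end NCFunctional

/-- The evolution equations for `Φ[ρ, ψ]`: first for a freely infinitely divisible state `ρ`, with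
its free convolution semigroup `ρ_t = ρ^{⊞ t}`, `t ≥ 0`, and a state `ψ`; then for arbitrary unital
linear functionals `ρ`, `ψ` and all real `t` for which the expressions are defined. -/
theorem mainTheorem1 (d : ℕ) :
    (∀ ρ ψ : NCFunctional d, ρ.IsFreelyInfinitelyDivisible → ψ.IsState →
      ∀ (a : Fin d → ℝ) (t : ℝ), 0 ≤ t →
        ((ρ.freePow t).freeConv (.delta a)).Phi ψ = ((ρ.Phi ψ).boolPow t).boolConv (.delta a) ∧
        ρ.Phi (ψ.freeConv (ρ.freePow t)) = (ρ.Phi ψ).BOne t ∧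
        (∀ φ : NCFunctional d, φ.condFreeCumulant ψ = ρ.freeCumulant →
          (φ.BOne t).condFreeCumulant (ψ.freeConv (ρ.freePow t)) = φ.condFreeCumulant ψ ∧
          (φ.BOne t).condFreeCumulant (ψ.freeConv (ρ.freePow t)) = ρ.freeCumulant) ∧
        ρ.Phi ((ψ.freeConv (ρ.freePow t)).freeConv (.delta a)) = (ρ.Phi ψ).BTwo a t ∧
        (ρ.Phi ψ).BTwo a t = (ρ.Phi (ψ.freeConv (.delta a))).BOne t ∧
        (ρ.Phi ψ).BTwo a t = (ρ.Phi (ψ.freeConv (ρ.freePow t))).BTwo a 0) ∧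
    (∀ (ρ ψ : NCFunctional d) (a : Fin d → ℝ) (t : ℝ),
      ((ρ.freePow t).freeConv (.delta a)).Phi ψ = ((ρ.Phi ψ).boolPow t).boolConv (.delta a) ∧
      (t ≠ -1 →
        ρ.Phi (ψ.freeConv (ρ.freePow t)) = (ρ.Phi ψ).BOne t ∧
        (∀ φ : NCFunctional d, φ.condFreeCumulant ψ = ρ.freeCumulant →
          (φ.BOne t).condFreeCumulant (ψ.freeConv (ρ.freePow t)) = φ.condFreeCumulant ψ ∧
          (φ.BOne t).condFreeCumulant (ψ.freeConv (ρ.freePow t)) = ρ.freeCumulant) ∧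
        ρ.Phi ((ψ.freeConv (ρ.freePow t)).freeConv (.delta a)) = (ρ.Phi ψ).BTwo a t ∧
        (ρ.Phi ψ).BTwo a t = (ρ.Phi (ψ.freeConv (.delta a))).BOne t ∧
        (ρ.Phi ψ).BTwo a t = (ρ.Phi (ψ.freeConv (ρ.freePow t))).BTwo a 0)) := by
  open NCFunctional in
  refine (and_iff_right_of_imp fun general ρ ψ _ _ a t ht => ?_).2 fun ρ ψ a t =>
    ⟨Phi_freePow_freeConv_delta ρ ψ a t, fun ht => ⟨Phi_freeConv_freePow ρ ψ ht, fun φ hφ => ?_,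
      Phi_freeConv_freePow_freeConv_delta ρ ψ a ht, BTwo_Phi_eq_BOne ρ ψ a ht,
      BTwo_Phi_eq_BTwo_zero ρ ψ a ht⟩⟩
  · exact (general ρ ψ a t).imp_right fun h => h (by linarith)
  · have hB := condFreeCumulant_BOne ht hφ
    exact ⟨hB.trans hφ.symm, hB⟩
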